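/- Fix $\tau\in(2,3)$ and $h_{\min}>0$. In the hidden-variable model on $n$ vertices, the vertices have i.i.d. hidden variables with density $\rho(h)=Ch^{-\tau}$ for $h\ge h_{\min}$ ($C$ the normalizing constant), with mean $\mu$; conditionally on the hidden variables, each pair of distinct vertices with hidden variables $h,h'$ is joined independently with probability $\min(hh'/(\mu n),1)$. Let $H$ be a fixed finite simple graph on $k$ vertices with edge set $E_H$, and let $N_g(H)$ be the number of induced copies of $H$, i.e. the number of $k$-element vertex sets whose induced subgraph is isomorphic to $H$. Define $$B_{g,f}(H)=\max_{(S_1,S_2,S_3)}\Big[|S_1|-|S_2|-\frac{2E_{S_1}+E_{S_1,S_3}}{\tau-1}\Big],$$ where the maximum is over all partitions of the vertices of $H$ into three (possibly empty) sets $S_1,S_2,S_3$ such that $\{u,v\}\in E_H$ for all $u\in S_2$ and all $v\in S_2\cup S_3$ with $v\ne u$; here $E_{S_1}$ is the number of edges of $H$ inside $S_1$ and $E_{S_1,S_3}$ the number of edges of $H$ between $S_1$ and $S_3$. **Theorem (General graphlets, expected).** If the maximum defining $B_{g,f}(H)$ is attained by a unique partition $\mathcal P^*$, then, as $n\to\infty$,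 $$\mathbb E[N_g(H)]=\Theta\Big(n^{\frac{3-\tau}{2}k+\frac{\tau-1}{2}B_{g,f}(H)}\Big),$$ where the implied constants may depend on $H$, $\tau$ and $h_{\min}$ but not on $n$. The order of growth is thus determined by $\mathcal P^*$, at which the bracket equals $B_{g,f}(H)$. -/

import Mathlib

open MeasureTheory ProbabilityTheory Filter Asymptotics

noncomputable section

/-! ### The hidden-variable model -/

/-- The law of a hidden variable: the probability measure with density `C * h ^ (-τ)` on
`[hmin, ∞)`, where `C = (τ - 1) * hmin ^ (τ - 1)` is the normalizing constant. -/
def hiddenVariableLaw (τ hmin : ℝ) : Measure ℝ := paretoMeasure hmin (τ - 1)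

/-- The mean `μ` of a hidden variable. -/
def hiddenVariableMean (τ hmin : ℝ) : ℝ := ∫ h, h ∂(hiddenVariableLaw τ hmin)

/-- The connection probability `p(h, h') = min (h h' / (μ n)) 1` on `n` vertices. -/
def connectionProb (τ hmin : ℝ) (n : ℕ) (h h' : ℝ) : ℝ :=
  min (h * h' / (hiddenVariableMean τ hmin * n)) 1

/-- A sample of the model on the vertices `Fin n`: the hidden variables of the vertices, and one
number in the unit interval for every pair of vertices. -/
abbrev HiddenVariableSample (n : ℕ) : Type := (Fin n → ℝ) × (Sym2 (Fin n) → unitInterval)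

/-- The hidden variables are i.i.d. with law `hiddenVariableLaw`; independently of them, the numbers
attached to the pairs are i.i.d. uniform on the unit interval. -/
def hiddenVariableMeasure (τ hmin : ℝ) (n : ℕ) : Measure (HiddenVariableSample n) :=
  (Measure.pi fun _ : Fin n => hiddenVariableLaw τ hmin).prod
    (Measure.pi fun _ : Sym2 (Fin n) => (volume : Measure unitInterval))

/-- The random graph: distinct vertices `i` and `j` are joined when the uniform number of the pair
lies below `p(h_i, h_j)`. Thus, conditionally on the hidden variables, the pairs are joined
independently, with probabilities `p(h_i, h_j)`. -/
def hiddenVariableGraph (τ hmin : ℝ) (n : ℕ) (ω : HiddenVariableSample n) :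
    SimpleGraph (Fin n) where
  Adj i j := i ≠ j ∧ (ω.2 s(i, j) : ℝ) < connectionProb τ hmin n (ω.1 i) (ω.1 j)
  symm := ⟨fun i j hij =>
    ⟨hij.1.symm, by
      have h := hij.2
      rw [Sym2.eq_swap] at h
      simpa only [connectionProb, mul_comm (ω.1 j) (ω.1 i)] using h⟩⟩
  loopless := ⟨fun _ hi => hi.1 rfl⟩

/-- The number of induced copies of `H` in `G`: the number of vertex sets of `G` that induce a
graph isomorphic to `H`. -/
def graphletCount {V W : Type*} (H : SimpleGraph V) (G : SimpleGraph W) : ℕ :=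
  {S : Set W | Nonempty (G.induce S ≃g H)}.ncard

/-- The expected number of induced copies of `H` in the hidden-variable model on `n` vertices. -/
def expectedGraphletCount {V : Type*} (τ hmin : ℝ) (H : SimpleGraph V) (n : ℕ) : ℝ :=
  ∫ ω, (graphletCount H (hiddenVariableGraph τ hmin n ω) : ℝ) ∂(hiddenVariableMeasure τ hmin n)

/-! ### The optimization problem -/

/-- An (ordered) partition of the vertices into three sets `S₁`, `S₂`, `S₃`, some of which may be
empty, given by the label `0`, `1` or `2` of each vertex. -/
abbrev VertexPartition (V : Type*) : Type _ := V → Fin 3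

namespace VertexPartition

variable {V : Type*}

/-- The set `S₁` of a partition. -/
def S₁ (P : VertexPartition V) : Set V := {v | P v = 0}

/-- The set `S₂` of a partition. -/
def S₂ (P : VertexPartition V) : Set V := {v | P v = 1}

/-- The set `S₃` of a partition. -/
def S₃ (P : VertexPartition V) : Set V := {v | P v = 2}

/-- The number `E_{S₁}` of edges of `H` inside `S₁`. -/
def edgesInS₁ (H : SimpleGraph V) (P : VertexPartition V) : ℕ :=
  {e ∈ H.edgeSet | ∀ v ∈ e, v ∈ S₁ P}.ncard

/-- The number `E_{S₁,S₃}` of edges of `H` between `S₁` and `S₃`. -/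
def edgesS₁S₃ (H : SimpleGraph V) (P : VertexPartition V) : ℕ :=
  {e ∈ H.edgeSet | (∃ u ∈ e, u ∈ S₁ P) ∧ ∃ v ∈ e, v ∈ S₃ P}.ncard

/-- The objective `|S₁| - |S₂| - (2 E_{S₁} + E_{S₁,S₃}) / (τ - 1)`. -/
def objective (τ : ℝ) (H : SimpleGraph V) (P : VertexPartition V) : ℝ :=
  ((S₁ P).ncard : ℝ) - ((S₂ P).ncard : ℝ)
    - (2 * (edgesInS₁ H P : ℝ) + (edgesS₁S₃ H P : ℝ)) / (τ - 1)

/-- The constraint: every vertex of `S₂` is adjacent in `H` to all other vertices of `S₂ ∪ S₃`. -/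
def Feasible (H : SimpleGraph V) (P : VertexPartition V) : Prop :=
  ∀ u ∈ S₂ P, ∀ v ∈ S₂ P ∪ S₃ P, u ≠ v → H.Adj u v

/-- `P` solves the optimization problem: it is feasible and maximizes the objective among the
feasible partitions. -/
def IsOptimizer (τ : ℝ) (H : SimpleGraph V) (P : VertexPartition V) : Prop :=
  Feasible H P ∧ ∀ Q, Feasible H Q → objective τ H Q ≤ objective τ H P

end VertexPartition

/-- The optimal value `B_{g,f}(H)`. -/
def graphletB {V : Type*} (τ : ℝ) (H : SimpleGraph V) : ℝ :=
  sSup (VertexPartition.objective τ H '' {P | VertexPartition.Feasible H P})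

/-- The supremum in the definition of `graphletB` is a maximum. -/
theorem graphletB_isGreatest {V : Type*} [Finite V] (τ : ℝ) (H : SimpleGraph V) :
    IsGreatest (VertexPartition.objective τ H '' {P | VertexPartition.Feasible H P})
      (graphletB τ H) := by
  have hne : (VertexPartition.objective τ H '' {P | VertexPartition.Feasible H P}).Nonempty :=
    ⟨_, fun _ => 0, fun u hu => by simp [VertexPartition.S₂] at hu, rfl⟩
  have hfin : (VertexPartition.objective τ H '' {P | VertexPartition.Feasible H P}).Finite :=
    (Set.toFinite _).image _
  exact ⟨hne.csSup_mem hfin, fun x hx => le_csSup hfin.bddAbove hx⟩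

end

/-! Up to constants the expected count is `n ^ k` times `patternProb`, the probability that `k`
labelled vertices induce `H`. Put `s = √(μ n)`, `x v = log (h v / s)` and `L = log (s / hmin)`. Then
`x v ≥ -L`, a pair is joined with probability `exp (min (x u + x v) 0)`, and the Pareto law
contributes `s ^ (-(τ - 1)) * exp (-(τ - 1) * x v) dx` up to a constant. A non-edge contributes a
factor at most `1`, which vanishes if `x u + x v ≥ 0`. So the integrand is at most `exp (logWeight τ
H x)` on the polyhedral region where `x v ≥ -L` and `x u + x v ≤ 0` for non-edges.

On this region `logWeight` is governed by points with coordinates in `{-L, 0, L}`. A point of `[-L,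
L]^V` is the integral over levels `θ ∈ (0, L]` of its roundings to `{-1, 0, 1}`. Rounding respects
the sign of each `x u + x v`, so it preserves the constraints and commutes with every `min`. The
roundings are exactly exponent vectors of feasible partitions, where `logWeight` is `(τ - 1)` times
the objective.

Uniqueness gives a gap at all other partitions, and integration over the levels turns it into a
linear decay `-c * ∑ |x v - L * z v|` away from the optimal vertex `L z` (`logWeight_le_of_unique`).
The upper bound then factors into one-dimensional integrals bounded uniformly in `n`, which rules
out logarithmic factors (`exists_patternProb_le`). The lower bound restricts the integral to a box
of fixed size near `L z` (`exists_le_patternProb`). -/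

noncomputable section

/-! ### Level rounding and its compatibility with pair sums -/

/-- The rounding of a real number to `-1`, `0` or `1` at the threshold `θ`. -/
def signAtLevel (θ a : ℝ) : ℝ := (if θ ≤ a then 1 else 0) - (if θ ≤ -a then 1 else 0)

theorem intervalIntegrable_ite_le (a b c : ℝ) :
    IntervalIntegrable (fun θ : ℝ => if θ ≤ a then (1 : ℝ) else 0) volume b c := by
  refine (AntitoneOn.intervalIntegrable fun x _ y _ hxy => ?_)
  split_ifs <;> linarith

theorem integral_ite_le {a b : ℝ} (hb : 0 ≤ b) (hab : a ≤ b) :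
    ∫ θ in (0 : ℝ)..b, (if θ ≤ a then (1 : ℝ) else 0) = max a 0 := by
  rw [intervalIntegral.integral_of_le hb]
  have h : (fun θ : ℝ => if θ ≤ a then (1 : ℝ) else 0) = (Set.Iic a).indicator fun _ => 1 := by
    ext θ; simp [Set.indicator_apply]
  rw [h, integral_indicator measurableSet_Iic, Measure.restrict_restrict measurableSet_Iic,
    Set.inter_comm, Set.Ioc_inter_Iic, min_eq_right hab]
  simp [Measure.real, Real.volume_Ioc, ENNReal.toReal_ofReal']

/-- Layer-cake formula, applied to the positive and negative parts of `a` separately. -/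
theorem integral_signAtLevel {a b : ℝ} (hab : |a| ≤ b) :
    ∫ θ in (0 : ℝ)..b, signAtLevel θ a = a := by
  have hb : 0 ≤ b := (abs_nonneg a).trans hab
  unfold signAtLevel
  rw [intervalIntegral.integral_sub (intervalIntegrable_ite_le _ _ _)
    (intervalIntegrable_ite_le _ _ _), integral_ite_le hb (le_of_abs_le hab),
    integral_ite_le hb (neg_le_of_abs_le hab |> fun h => by linarith)]
  exact max_zero_sub_max_neg_zero_eq_self a

theorem intervalIntegrable_signAtLevel (a b c : ℝ) :
    IntervalIntegrable (fun θ => signAtLevel θ a) volume b c :=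
  (intervalIntegrable_ite_le _ _ _).sub (intervalIntegrable_ite_le _ _ _)

/-- A linear functional that is at most `K` at every level rounding of `x` is at most `L * K`
at `x`. -/
theorem linearMap_le_of_signAtLevel_le {V : Type*} [Fintype V] (Λ : (V → ℝ) →ₗ[ℝ] ℝ) {x : V → ℝ}
    {L K : ℝ} (hL : 0 ≤ L) (hx : ∀ v, |x v| ≤ L)
    (h : ∀ θ, 0 < θ → θ ≤ L → Λ (fun v => signAtLevel θ (x v)) ≤ K) : Λ x ≤ L * K := by
  classical
  have hint : ∀ v ∈ Finset.univ, IntervalIntegrable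
      (fun θ => signAtLevel θ (x v) * Λ (fun j => if v = j then 1 else 0)) volume 0 L :=
    fun v _ => (intervalIntegrable_signAtLevel _ _ _).mul_const _
  have hΛ : ∀ w : V → ℝ, Λ w = ∑ v, w v * Λ (fun j => if v = j then 1 else 0) :=
    fun w => LinearMap.pi_apply_eq_sum_univ Λ w
  -- In coordinates `Λ` is a finite sum, so it commutes with the integral over levels.
  have key : Λ x = ∫ θ in (0 : ℝ)..L, Λ (fun v => signAtLevel θ (x v)) := by
    rw [hΛ x, funext fun θ => hΛ fun v => signAtLevel θ (x v)]
    rw [intervalIntegral.integral_finsetSum hint]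
    refine Finset.sum_congr rfl fun v _ => ?_
    rw [intervalIntegral.integral_mul_const, integral_signAtLevel (hx v)]
  have hint' : IntervalIntegrable (fun θ => Λ (fun v => signAtLevel θ (x v))) volume 0 L := by
    rw [funext fun θ => hΛ fun v => signAtLevel θ (x v)]
    have := IntervalIntegrable.sum _ hint
    rwa [Finset.sum_fn] at this
  rw [key]
  calc _ ≤ ∫ _ in (0 : ℝ)..L, K := by
        refine intervalIntegral.integral_mono_on_of_le_Ioo hL hint' (by simp) fun θ hθ => ?_
        exact h θ hθ.1 hθ.2.le
    _ = L * K := by simp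

/-- The sum of the values of `x` at the two ends of a pair, as a linear functional of `x`. -/
def pairSum {V : Type*} : Sym2 V → (V → ℝ) →ₗ[ℝ] ℝ :=
  Sym2.lift ⟨fun u v => LinearMap.proj u + LinearMap.proj v, fun _ _ => add_comm _ _⟩

@[simp]
theorem pairSum_mk {V : Type*} (u v : V) (x : V → ℝ) : pairSum s(u, v) x = x u + x v := rfl

/-- If `a + b ≤ 0`, then `θ ≤ a` forces `θ ≤ -b`, so a rounding `1` is always matched by a rounding
`-1`; the case `a + b > 0` is symmetric. Hence the branch of the minimum active at `(a, b)` stays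
active at every level, which makes the minimum linear along the roundings. -/
theorem min_signAtLevel_add {θ a b : ℝ} (hθ : 0 < θ) :
    min (signAtLevel θ a + signAtLevel θ b) 0 =
      if a + b ≤ 0 then signAtLevel θ a + signAtLevel θ b else 0 := by
  unfold signAtLevel
  grind

theorem signAtLevel_add_nonpos {θ a b : ℝ} (hθ : 0 < θ) (h : a + b ≤ 0) :
    signAtLevel θ a + signAtLevel θ b ≤ 0 := by
  unfold signAtLevel
  grind

theorem fin_three_cases (a : Fin 3) : a = 0 ∨ a = 1 ∨ a = 2 := by
  fin_cases a <;> simp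

/-! ### Partitions as vectors with entries in `{-1, 0, 1}` -/

namespace VertexPartition

variable {V : Type*}

/-- The exponent attached to a label: `-1` on `S₁`, `1` on `S₂` and `0` on `S₃`. -/
def exponent (P : VertexPartition V) (v : V) : ℝ :=
  if P v = 0 then -1 else if P v = 1 then 1 else 0

/-- The label pairs with positive exponent sum are exactly `S₂`–`S₂` and `S₂`–`S₃`, the ones that
feasibility forbids for non-adjacent vertices. In this form the constraint is the same as the one on
logarithmic coordinates. -/
theorem feasible_iff {H : SimpleGraph V} {P : VertexPartition V} :
    Feasible H P ↔ ∀ u v, u ≠ v → ¬ H.Adj u v → exponent P u + exponent P v ≤ 0 := by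
  have aux : ∀ a b : Fin 3, ((if a = 0 then -1 else if a = 1 then 1 else 0 : ℝ) +
      (if b = 0 then -1 else if b = 1 then 1 else 0 : ℝ) ≤ 0) ↔
      ¬ (a = 1 ∧ (b = 1 ∨ b = 2)) ∧ ¬ (b = 1 ∧ (a = 1 ∨ a = 2)) := by
    intro a b
    rcases fin_three_cases a with rfl | rfl | rfl <;>
      rcases fin_three_cases b with rfl | rfl | rfl <;> grind
  simp only [exponent, aux]
  simp only [Feasible, S₂, S₃, Set.mem_ofPred_eq, Set.mem_union]
  constructor
  · intro h u v huv hn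
    exact ⟨fun ⟨h1, h2⟩ => hn (h u h1 v h2 huv),
      fun ⟨h1, h2⟩ => hn (h v h1 u h2 huv.symm).symm⟩
  · intro h u hu v hv huv
    by_contra hn
    exact (h u v huv hn).1 ⟨hu, hv⟩

theorem exists_exponent_eq_signAtLevel (θ : ℝ) (hθ : 0 < θ) (x : V → ℝ) :
    ∃ Q : VertexPartition V, exponent Q = fun v => signAtLevel θ (x v) := by
  refine ⟨fun v => if θ ≤ -x v then 0 else if θ ≤ x v then 1 else 2, funext fun v => ?_⟩
  unfold exponent signAtLevel
  grind

end VertexPartition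

/-! ### Maximization of the logarithmic weight -/

open VertexPartition

variable {V : Type*} [Fintype V]

/-- The logarithm of the integrand in logarithmic coordinates. -/
def logWeight (τ : ℝ) (H : SimpleGraph V) (x : V → ℝ) : ℝ := by
  classical
  exact ∑ e ∈ H.edgeFinset, min (pairSum e x) 0 - (τ - 1) * ∑ v, x v

/-- An edge costs `2` inside `S₁`, `1` between `S₁` and `S₃`, and nothing otherwise; the linear term
counts `|S₁| - |S₂|`. -/
theorem logWeight_exponent {τ : ℝ} (hτ : 2 < τ) (H : SimpleGraph V) (P : VertexPartition V) :
    logWeight τ H (exponent P) = (τ - 1) * objective τ H P := by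
  classical
  have hcard : ∀ p : V → Prop, (({v | p v}.ncard : ℕ) : ℝ) = ∑ v, if p v then 1 else 0 := by
    intro p
    rw [Set.ncard_eq_toFinset_card']
    simp
  have hedge : ∀ p : Sym2 V → Prop, (({e ∈ H.edgeSet | p e}.ncard : ℕ) : ℝ) =
      ∑ e ∈ H.edgeFinset, if p e then 1 else 0 := by
    intro p
    rw [Set.ncard_eq_toFinset_card', Finset.sum_boole]
    congr 2
    ext e
    simp
  have hτ' : τ - 1 ≠ 0 := by linarith
  have hvert : ∑ v, exponent P v = ((S₂ P).ncard : ℝ) - (S₁ P).ncard := by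
    rw [S₁, S₂, hcard, hcard, ← Finset.sum_sub_distrib]
    refine Finset.sum_congr rfl fun v _ => ?_
    unfold exponent
    generalize P v = a
    rcases fin_three_cases a with rfl | rfl | rfl <;> grind
  have hedges : ∑ e ∈ H.edgeFinset, min (pairSum e (exponent P)) 0 =
      -(2 * (edgesInS₁ H P : ℝ) + edgesS₁S₃ H P) := by
    rw [edgesInS₁, edgesS₁S₃, hedge, hedge, Finset.mul_sum, ← Finset.sum_add_distrib,
      ← Finset.sum_neg_distrib]
    refine Finset.sum_congr rfl fun e _ => ?_
    induction e with | _ u v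
    simp only [pairSum_mk, exponent, S₁, S₃, Sym2.mem_iff, Set.mem_ofPred_eq, forall_eq_or_imp,
      forall_eq, exists_eq_or_imp, exists_eq_left]
    generalize P u = a
    generalize P v = b
    rcases fin_three_cases a with rfl | rfl | rfl <;>
      rcases fin_three_cases b with rfl | rfl | rfl <;> grind
  rw [logWeight, hvert, hedges, objective]
  field_simp
  ring

/-- There are finitely many partitions and all feasible competitors are strictly worse, so a small
`c` works for all of them. The bound `c < τ - 1` serves later to absorb coordinates larger than `L`.
-/
theorem exists_gap {τ : ℝ} (hτ : 2 < τ) {H : SimpleGraph V} {P : VertexPartition V}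
    (hP : IsOptimizer τ H P) (hunique : ∀ Q : VertexPartition V, IsOptimizer τ H Q → Q = P) :
    ∃ c, 0 < c ∧ c < τ - 1 ∧ ∀ Q, Feasible H Q →
      logWeight τ H (exponent Q) + c * ∑ v, |exponent Q v - exponent P v| ≤
        logWeight τ H (exponent P) := by
  have h1 : ∀ᶠ c : ℝ in nhdsWithin 0 (Set.Ioi 0), c < τ - 1 :=
    nhdsWithin_le_nhds (Iio_mem_nhds (by linarith))
  have h2 : ∀ᶠ c : ℝ in nhdsWithin 0 (Set.Ioi 0), ∀ Q, Feasible H Q →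
      logWeight τ H (exponent Q) + c * ∑ v, |exponent Q v - exponent P v| ≤
        logWeight τ H (exponent P) := by
    rw [eventually_all]
    intro Q
    by_cases hQ : Feasible H Q
    swap
    · exact Eventually.of_forall fun c h => absurd h hQ
    by_cases hQP : Q = P
    · subst hQP
      simp
    have hlt : logWeight τ H (exponent Q) < logWeight τ H (exponent P) := by
      rw [logWeight_exponent hτ, logWeight_exponent hτ]
      refine mul_lt_mul_of_pos_left (lt_of_le_of_ne (hP.2 Q hQ) fun heq => hQP ?_) (by linarith)
      exact hunique Q ⟨hQ, fun R hR => heq ▸ hP.2 R hR⟩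
    have hc : ContinuousAt (fun c : ℝ => logWeight τ H (exponent Q) +
        c * ∑ v, |exponent Q v - exponent P v|) 0 := by fun_prop
    have := hc.eventually_lt_const (u := logWeight τ H (exponent P)) (by simpa using hlt)
    exact nhdsWithin_le_nhds (this.mono fun c h _ => h.le)
  obtain ⟨c, ⟨hc1, hc2⟩, hc3⟩ := ((h1.and h2).and self_mem_nhdsWithin).exists
  exact ⟨c, hc3, hc1, hc2⟩

/-- The logarithmic weight drops linearly away from the unique optimizer. -/
theorem logWeight_le_of_unique {τ : ℝ} (hτ : 2 < τ) {H : SimpleGraph V} {P : VertexPartition V}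
    (hP : IsOptimizer τ H P) (hunique : ∀ Q : VertexPartition V, IsOptimizer τ H Q → Q = P) :
    ∃ c, 0 < c ∧ ∀ (L : ℝ) (x : V → ℝ), 0 ≤ L → (∀ v, -L ≤ x v) →
      (∀ u v, u ≠ v → ¬ H.Adj u v → x u + x v ≤ 0) →
      logWeight τ H x ≤ L * ((τ - 1) * objective τ H P) - c * ∑ v, |x v - L * exponent P v| := by
  classical
  obtain ⟨c, hc, hcτ, hgap⟩ := exists_gap hτ hP hunique
  rw [← logWeight_exponent hτ]
  refine ⟨c, hc, fun L x hL hx hn => ?_⟩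
  set z := exponent P with hz
  -- The layer-cake formula needs coordinates in `[-L, L]`, whereas `x` is bounded only from below.
  set y : V → ℝ := fun v => min (x v) L with hy
  have hyL : ∀ v, |y v| ≤ L := fun v =>
    abs_le.2 ⟨le_min (hx v) (by linarith), min_le_right _ _⟩
  have hyn : ∀ u v, u ≠ v → ¬ H.Adj u v → y u + y v ≤ 0 := fun u v h1 h2 =>
    (add_le_add (min_le_left _ _) (min_le_left _ _)).trans (hn u v h1 h2)
  -- truncating from above changes only the linear part
  have htrunc : logWeight τ H x = logWeight τ H y - (τ - 1) * ∑ v, (x v - y v) := by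
    -- If `x u > L`, then `x v ≥ -L` makes the pair sum nonnegative both before and after
    -- truncation.
    have : ∀ e ∈ H.edgeFinset, min (pairSum e x) 0 = min (pairSum e y) 0 := by
      intro e _
      induction e with | _ u v
      simp only [pairSum_mk, hy]
      have := hx u
      have := hx v
      grind
    rw [logWeight, logWeight, Finset.sum_congr rfl this, Finset.sum_sub_distrib]
    ring
  have hdist : ∑ v, |x v - L * z v| ≤ ∑ v, |y v - L * z v| + ∑ v, (x v - y v) := by
    rw [← Finset.sum_add_distrib]
    refine Finset.sum_le_sum fun v _ => ?_
    have h0 : 0 ≤ x v - y v := sub_nonneg.2 (min_le_left _ _)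
    calc |x v - L * z v| = |(y v - L * z v) + (x v - y v)| := by ring_nf
      _ ≤ _ := (abs_add_le _ _).trans (by rw [abs_of_nonneg h0])
  have hpos : 0 ≤ ∑ v, (x v - y v) :=
    Finset.sum_nonneg fun v _ => sub_nonneg.2 (min_le_left _ _)
  suffices hmain : logWeight τ H y + c * ∑ v, |y v - L * z v| ≤ L * logWeight τ H z by
    rw [htrunc]
    -- The excess over `L` lowers the weight at rate `τ - 1` and raises the distance term at rate at
    -- most `c < τ - 1`.
    nlinarith [mul_le_mul_of_nonneg_left hdist hc.le, mul_le_mul_of_nonneg_right hcτ.le hpos]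
  set s : V → ℝ := fun v => if 0 ≤ y v - L * z v then 1 else -1 with hs
  have hs1 : ∀ v, |y v - L * z v| = s v * (y v - L * z v) := by
    intro v
    simp only [hs]
    split_ifs with h
    · rw [abs_of_nonneg h, one_mul]
    · rw [abs_of_neg (not_le.1 h), neg_one_mul]
  have hs2 : ∀ v (t : ℝ), s v * t ≤ |t| := by
    intro v t
    simp only [hs]
    split_ifs
    · rw [one_mul]; exact le_abs_self t
    · rw [neg_one_mul]; exact neg_le_abs t
  -- `Λ` freezes the linear pieces of the minima and absolute values that are active at `y`. At the
  -- roundings of `y` the minima are still exact, while the frozen absolute values are only lower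
  -- bounds, which is the direction needed.
  set Λ : (V → ℝ) →ₗ[ℝ] ℝ := ∑ e ∈ H.edgeFinset, (if pairSum e y ≤ 0 then pairSum e else 0) -
    (τ - 1) • ∑ v, LinearMap.proj v + c • ∑ v, s v • LinearMap.proj v with hΛ
  have hΛ_apply : ∀ w : V → ℝ,
      (∀ e, min (pairSum e w) 0 = if pairSum e y ≤ 0 then pairSum e w else 0) →
      Λ w = logWeight τ H w + c * ∑ v, s v * w v := by
    intro w hw
    simp only [hΛ, logWeight, hw, LinearMap.add_apply, LinearMap.sub_apply, LinearMap.smul_apply,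
      LinearMap.sum_apply, LinearMap.proj_apply, smul_eq_mul]
    congr 2
    refine Finset.sum_congr rfl fun e _ => ?_
    split_ifs <;> rfl
  have hlin := linearMap_le_of_signAtLevel_le Λ (K := logWeight τ H z + c * ∑ v, s v * z v)
    hL hyL fun θ hθ _ => by
      rw [hΛ_apply]
      · obtain ⟨Q, hQ⟩ := exists_exponent_eq_signAtLevel θ hθ y
        have hQf : Feasible H Q := by
          rw [feasible_iff, hQ]
          exact fun u v h1 h2 => signAtLevel_add_nonpos hθ (hyn u v h1 h2)
        have h1 := hgap Q hQf
        change logWeight τ H (fun v => signAtLevel θ (y v)) +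
          c * ∑ v, s v * (fun v => signAtLevel θ (y v)) v ≤ _
        rw [← hQ]
        have h2 : ∑ v, s v * exponent Q v ≤
            ∑ v, |exponent Q v - z v| + ∑ v, s v * z v := by
          rw [← Finset.sum_add_distrib]
          refine Finset.sum_le_sum fun v _ => ?_
          have := hs2 v (exponent Q v - z v)
          linarith
        nlinarith [mul_le_mul_of_nonneg_left h2 hc.le]
      · intro e
        induction e with | _ u v
        exact min_signAtLevel_add hθ
  rw [hΛ_apply] at hlin
  · simp_rw [hs1]
    have : ∑ v, s v * (y v - L * z v) = ∑ v, s v * y v - L * ∑ v, s v * z v := by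
      rw [Finset.mul_sum, ← Finset.sum_sub_distrib]
      exact Finset.sum_congr rfl fun v _ => by ring
    rw [this]
    linarith
  · intro e
    split_ifs with h
    · exact min_eq_left h
    · exact min_eq_right (not_le.1 h).le

end

/-! ### Integrals against Pareto laws and product measures -/

noncomputable section

theorem setLIntegral_Ioc_rpow_sub_one {a c : ℝ} (ha : 0 < a) (hc : 0 < c) :
    ∫⁻ x in Set.Ioc 0 a, ENNReal.ofReal (x ^ (c - 1)) = ENNReal.ofReal (a ^ c / c) := by
  have hint : IntervalIntegrable (fun x : ℝ => x ^ (c - 1)) volume 0 a :=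
    intervalIntegral.intervalIntegrable_rpow' (by linarith)
  rw [← ofReal_integral_eq_lintegral_ofReal
    ((intervalIntegrable_iff_integrableOn_Ioc_of_le ha.le).1 hint),
    ← intervalIntegral.integral_of_le ha.le, integral_rpow (Or.inl (by linarith))]
  · simp [Real.zero_rpow hc.ne']
  · filter_upwards [ae_restrict_mem measurableSet_Ioc] with x hx
    exact Real.rpow_nonneg hx.1.le _

theorem setLIntegral_Ioi_rpow_neg_sub_one {a c : ℝ} (ha : 0 < a) (hc : 0 < c) :
    ∫⁻ x in Set.Ioi a, ENNReal.ofReal (x ^ (-c - 1)) = ENNReal.ofReal (a ^ (-c) / c) := by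
  rw [← ofReal_integral_eq_lintegral_ofReal
    (integrableOn_Ioi_rpow_of_lt (by linarith) ha), integral_Ioi_rpow_of_lt (by linarith) ha]
  · simp [neg_div_neg_eq]
  · filter_upwards [ae_restrict_mem measurableSet_Ioi] with x hx
    exact Real.rpow_nonneg (ha.trans hx).le _

/-- In the variable `log x` this is the integral of a two-sided exponential, so the bound does not
depend on the centre `log a`. Each side of `a` contributes `1 / c`. -/
theorem setLIntegral_Ioi_inv_mul_exp_abs_log_le {a c : ℝ} (ha : 0 < a) (hc : 0 < c) :
    ∫⁻ x in Set.Ioi 0, ENNReal.ofReal (x⁻¹ * Real.exp (-(c * |Real.log x - Real.log a|))) ≤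
      ENNReal.ofReal (2 / c) := by
  rw [← Set.Ioc_union_Ioi_eq_Ioi ha.le,
    lintegral_union measurableSet_Ioi (Set.Ioc_disjoint_Ioi le_rfl)]
  have h1 : ∫⁻ x in Set.Ioc 0 a,
      ENNReal.ofReal (x⁻¹ * Real.exp (-(c * |Real.log x - Real.log a|))) =
      ENNReal.ofReal (1 / c) := by
    calc _ = ∫⁻ x in Set.Ioc 0 a, ENNReal.ofReal (a ^ (-c)) * ENNReal.ofReal (x ^ (c - 1)) := by
          refine setLIntegral_congr_fun measurableSet_Ioc fun x hx => ?_
          rw [← ENNReal.ofReal_mul (by positivity), Real.rpow_sub_one hx.1.ne',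
            abs_of_nonpos (sub_nonpos.2 (Real.log_le_log hx.1 hx.2)),
            Real.rpow_def_of_pos ha, Real.rpow_def_of_pos hx.1, mul_div_assoc', ← Real.exp_add]
          congr 1
          rw [div_eq_inv_mul]
          congr 2
          ring
      _ = ENNReal.ofReal (1 / c) := by
          rw [lintegral_const_mul' _ _ ENNReal.ofReal_ne_top, setLIntegral_Ioc_rpow_sub_one ha hc,
            ← ENNReal.ofReal_mul (by positivity), mul_div_assoc', ← Real.rpow_add ha]
          simp
  have h2 : ∫⁻ x in Set.Ioi a,
      ENNReal.ofReal (x⁻¹ * Real.exp (-(c * |Real.log x - Real.log a|))) =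
      ENNReal.ofReal (1 / c) := by
    calc _ = ∫⁻ x in Set.Ioi a, ENNReal.ofReal (a ^ c) * ENNReal.ofReal (x ^ (-c - 1)) := by
          refine setLIntegral_congr_fun measurableSet_Ioi fun x hx => ?_
          have hx0 : 0 < x := ha.trans hx
          rw [← ENNReal.ofReal_mul (by positivity), Real.rpow_sub_one hx0.ne',
            abs_of_nonneg (sub_nonneg.2 (Real.log_le_log ha (le_of_lt hx))),
            Real.rpow_def_of_pos ha, Real.rpow_def_of_pos hx0, mul_div_assoc', ← Real.exp_add]
          congr 1
          rw [div_eq_inv_mul]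
          congr 2
          ring
      _ = ENNReal.ofReal (1 / c) := by
          rw [lintegral_const_mul' _ _ ENNReal.ofReal_ne_top,
            setLIntegral_Ioi_rpow_neg_sub_one ha hc,
            ← ENNReal.ofReal_mul (by positivity), mul_div_assoc', ← Real.rpow_add ha]
          simp
  rw [h1, h2, ← ENNReal.ofReal_add (by positivity) (by positivity)]
  apply le_of_eq
  congr 1
  ring

theorem lintegral_paretoMeasure {t r : ℝ} {g : ℝ → ENNReal} (hg : Measurable g) :
    ∫⁻ h, g h ∂(paretoMeasure t r) =
      ∫⁻ h in Set.Ici t, ENNReal.ofReal (r * t ^ r * h ^ (-(r + 1))) * g h := by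
  have hm : Measurable (paretoPDF t r) := (measurable_paretoPDFReal t r).ennreal_ofReal
  rw [paretoMeasure, lintegral_withDensity_eq_lintegral_mul _ hm hg,
    ← lintegral_indicator measurableSet_Ici]
  refine lintegral_congr fun h => ?_
  by_cases hh : t ≤ h
  · rw [Set.indicator_of_mem (Set.mem_Ici.2 hh), Pi.mul_apply, paretoPDF_of_le hh]
  · rw [Set.indicator_of_notMem (by simpa using hh), Pi.mul_apply,
      paretoPDF_of_lt (not_le.1 hh), zero_mul]

theorem ae_paretoMeasure_ge (t r : ℝ) : ∀ᵐ h ∂(paretoMeasure t r), t ≤ h := by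
  rw [ae_iff]
  have : {h : ℝ | ¬ t ≤ h} = Set.Iio t := by ext; simp
  rw [this, paretoMeasure, withDensity_apply _ measurableSet_Iio,
    lintegral_paretoPDF_of_le le_rfl]

/-- The integral of a peaked power function against a Pareto law. -/
theorem lintegral_exp_log_paretoMeasure_le {t r c s : ℝ} (ht : 0 < t) (hr : 0 < r) (hc : 0 < c)
    (hs : 0 < s) (l : ℝ) :
    ∫⁻ h, ENNReal.ofReal (Real.exp (r * Real.log (h / s) - c * |Real.log (h / s) - l|))
      ∂(paretoMeasure t r) ≤ ENNReal.ofReal (r * t ^ r * (2 / c) * s ^ (-r)) := by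
  rw [lintegral_paretoMeasure (by fun_prop)]
  have ha : 0 < s * Real.exp l := by positivity
  -- The factor `(h / s) ^ r` cancels the Pareto tail and leaves `s ^ (-r)` times the
  -- scale-invariant measure `dh / h`, with the peak at `s * exp l`.
  calc _ = ∫⁻ h in Set.Ici t, ENNReal.ofReal (r * t ^ r * s ^ (-r)) *
        ENNReal.ofReal (h⁻¹ * Real.exp (-(c * |Real.log h - Real.log (s * Real.exp l)|))) := by
        refine setLIntegral_congr_fun measurableSet_Ici fun h hh => ?_
        have hh0 : 0 < h := ht.trans_le hh
        rw [← ENNReal.ofReal_mul (by positivity), ← ENNReal.ofReal_mul (by positivity),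
          Real.log_div hh0.ne' hs.ne', Real.log_mul hs.ne' (Real.exp_pos _).ne', Real.log_exp]
        congr 1
        rw [neg_add, Real.rpow_add hh0, Real.rpow_neg_one, sub_sub, Real.rpow_def_of_pos hh0,
          Real.rpow_def_of_pos hs]
        have : r * (Real.log h - Real.log s) - c * |Real.log h - (Real.log s + l)| =
          -(Real.log h * -r) + Real.log s * -r + -(c * |Real.log h - (Real.log s + l)|) := by
          ring
        rw [this, Real.exp_add, Real.exp_add, Real.exp_neg]
        field_simp
    _ ≤ ENNReal.ofReal (r * t ^ r * s ^ (-r)) * ENNReal.ofReal (2 / c) := by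
        rw [lintegral_const_mul' _ _ ENNReal.ofReal_ne_top]
        gcongr
        refine (lintegral_mono_set fun h hh => ?_).trans
          (setLIntegral_Ioi_inv_mul_exp_abs_log_le ha hc)
        exact ht.trans_le hh
    _ = _ := by
        rw [← ENNReal.ofReal_mul (by positivity)]
        congr 1
        ring

/-- A Pareto law gives mass of order `a ^ (-r)` to the interval `[a, e a]`. -/
theorem le_paretoMeasure_Icc {t r a : ℝ} (ht : 0 < t) (hr : 0 < r) (ha : t ≤ a) :
    ENNReal.ofReal (r * t ^ r * Real.exp (-(r + 1)) * a ^ (-r)) ≤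
      paretoMeasure t r (Set.Icc a (Real.exp 1 * a)) := by
  have ha0 : 0 < a := ht.trans_le ha
  rw [paretoMeasure, withDensity_apply _ measurableSet_Icc]
  have he : (2 : ℝ) ≤ Real.exp 1 := by
    have := Real.add_one_le_exp 1
    linarith
  calc ENNReal.ofReal (r * t ^ r * Real.exp (-(r + 1)) * a ^ (-r))
      ≤ ENNReal.ofReal (r * t ^ r * (Real.exp 1 * a) ^ (-(r + 1))) *
          volume (Set.Icc a (Real.exp 1 * a)) := by
        rw [Real.volume_Icc, ← ENNReal.ofReal_mul (by positivity)]
        apply ENNReal.ofReal_le_ofReal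
        rw [Real.mul_rpow (Real.exp_pos _).le ha0.le, Real.exp_one_rpow]
        have h1 : a ^ (-r) = a ^ (-(r + 1)) * a := by
          rw [← Real.rpow_add_one ha0.ne']
          congr 1
          ring
        rw [h1]
        have h2 : a ≤ Real.exp 1 * a - a := by nlinarith
        have h3 : 0 ≤ r * t ^ r * Real.exp (-(r + 1)) * a ^ (-(r + 1)) := by positivity
        nlinarith [mul_le_mul_of_nonneg_left h2 h3]
    _ = ∫⁻ _ in Set.Icc a (Real.exp 1 * a),
          ENNReal.ofReal (r * t ^ r * (Real.exp 1 * a) ^ (-(r + 1))) := by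
        rw [setLIntegral_const]
    _ ≤ _ := by
        refine setLIntegral_mono' measurableSet_Icc fun h hh => ?_
        rw [paretoPDF_of_le (ha.trans hh.1)]
        apply ENNReal.ofReal_le_ofReal
        have h0 : 0 < h := ha0.trans_le hh.1
        have := Real.rpow_le_rpow_of_nonpos h0 hh.2 (z := -(r + 1)) (by linarith)
        gcongr

theorem integrable_id_paretoMeasure {t r : ℝ} (ht : 0 < t) (hr : 1 < r) :
    Integrable (fun h : ℝ => h) (paretoMeasure t r) := by
  have hm : Measurable (paretoPDF t r) := (measurable_paretoPDFReal t r).ennreal_ofReal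
  rw [paretoMeasure, integrable_withDensity_iff hm (by simp [paretoPDF])]
  have hint : IntegrableOn (fun h : ℝ => r * t ^ r * h ^ (-r)) (Set.Ici t) := by
    rw [integrableOn_Ici_iff_integrableOn_Ioi]
    exact (integrableOn_Ioi_rpow_of_lt (by linarith) ht).const_mul _
  refine (hint.integrable_indicator measurableSet_Ici).congr (Eventually.of_forall fun h => ?_)
  dsimp only
  by_cases hh : t ≤ h
  · have h0 : 0 < h := ht.trans_le hh
    rw [Set.indicator_of_mem (Set.mem_Ici.2 hh), paretoPDF_of_le hh,
      ENNReal.toReal_ofReal (by positivity), neg_add, Real.rpow_add h0, Real.rpow_neg_one]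
    field_simp
  · rw [Set.indicator_of_notMem (by simpa using hh), paretoPDF_of_lt (not_le.1 hh)]
    simp

theorem isProbabilityMeasure_hiddenVariableLaw {τ hmin : ℝ} (hτ : 2 < τ) (hh : 0 < hmin) :
    IsProbabilityMeasure (hiddenVariableLaw τ hmin) :=
  isProbabilityMeasure_paretoMeasure hh (by linarith)

theorem hiddenVariableMean_pos {τ hmin : ℝ} (hτ : 2 < τ) (hh : 0 < hmin) :
    0 < hiddenVariableMean τ hmin := by
  have := isProbabilityMeasure_hiddenVariableLaw hτ hh
  refine hh.trans_le ?_
  have hle := integral_mono_ae (μ := hiddenVariableLaw τ hmin) (integrable_const hmin)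
    (integrable_id_paretoMeasure hh (by linarith)) (ae_paretoMeasure_ge hmin (τ - 1))
  simpa [hiddenVariableMean] using hle

theorem lintegral_pi_prod {ι : Type*} [Fintype ι] {α : Type*} [MeasurableSpace α]
    (μ : Measure α) [IsProbabilityMeasure μ] {f : ι → α → ENNReal} (hf : ∀ i, Measurable (f i)) :
    ∫⁻ x, ∏ i, f i (x i) ∂(Measure.pi fun _ => μ) = ∏ i, ∫⁻ a, f i a ∂μ := by
  rw [lintegral_prod_eq_prod_lintegral_of_indepFun Finset.univ (fun i (x : ι → α) => f i (x i))
    (iIndepFun_pi fun i => (hf i).aemeasurable) fun i => (hf i).comp (measurable_pi_apply i)]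
  refine Finset.prod_congr rfl fun i _ => ?_
  rw [← (measurePreserving_eval (fun _ : ι => μ) i).lintegral_comp (hf i)]

/-- Restriction along an injection preserves powers of a probability measure. -/
theorem measurePreserving_comp_injective {ι κ : Type*} [Fintype ι] [Fintype κ] {α : Type*}
    [MeasurableSpace α] (μ : Measure α) [IsProbabilityMeasure μ] {φ : ι → κ}
    (hφ : Function.Injective φ) :
    MeasurePreserving (fun x : κ → α => x ∘ φ) (Measure.pi fun _ => μ) (Measure.pi fun _ => μ) := by
  classical
  have hm : Measurable (fun x : κ → α => x ∘ φ) :=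
    measurable_pi_lambda _ fun i => measurable_pi_apply _
  refine ⟨hm, (Measure.pi_eq fun s hs => ?_).symm⟩
  rw [Measure.map_apply hm (MeasurableSet.univ_pi hs)]
  -- The intersection handles both cases at once: by injectivity it is a single `s i` for `k` in the
  -- range of `φ`, and the whole space, of measure `1`, otherwise.
  have : (fun x : κ → α => x ∘ φ) ⁻¹' Set.univ.pi s =
      Set.univ.pi fun k => ⋂ (i : ι) (_ : φ i = k), s i := by
    ext x
    simp only [Set.mem_preimage, Set.mem_univ_pi, Function.comp_apply, Set.mem_iInter]
    exact ⟨fun h k i hi => hi ▸ h i, fun h i => h _ i rfl⟩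
  rw [this, Measure.pi_pi]
  rw [← Finset.prod_subset (Finset.subset_univ (Finset.univ.image φ)),
    Finset.prod_image hφ.injOn]
  · refine Finset.prod_congr rfl fun i _ => ?_
    congr 1
    ext a
    simp [hφ.eq_iff]
  · intro k _ hk
    have : (⋂ (i : ι) (_ : φ i = k), s i) = Set.univ := by
      ext a
      simp only [Set.mem_iInter, Set.mem_univ, iff_true]
      rintro i rfl
      simp at hk
    rw [this, measure_univ]

end

/-! ### From the expected count to the probability of a labelled pattern -/

noncomputable section

/-- The connection probability of a pair of vertices. -/
def pairProb {V : Type*} (τ hmin : ℝ) (n : ℕ) (h : V → ℝ) : Sym2 V → ℝ :=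
  Sym2.lift ⟨fun u v => connectionProb τ hmin n (h u) (h v), fun u v => by
    simp only [connectionProb, mul_comm]⟩

@[simp]
theorem pairProb_mk {V : Type*} (τ hmin : ℝ) (n : ℕ) (h : V → ℝ) (u v : V) :
    pairProb τ hmin n h s(u, v) = connectionProb τ hmin n (h u) (h v) := rfl

/-- The event that the hidden variables and the pair variables indexed by `V` produce `H`. -/
def patternEvent {V : Type*} (τ hmin : ℝ) (n : ℕ) (H : SimpleGraph V) :
    Set ((V → ℝ) × (Sym2 V → unitInterval)) :=
  {ω | ∀ u v, u ≠ v →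
    ((ω.2 s(u, v) : ℝ) < connectionProb τ hmin n (ω.1 u) (ω.1 v) ↔ H.Adj u v)}

/-- The probability that `V` labelled vertices of the model on `n` vertices induce `H`. -/
def patternProb {V : Type*} [Fintype V] (τ hmin : ℝ) (n : ℕ) (H : SimpleGraph V) : ENNReal := by
  classical
  exact ((Measure.pi fun _ : V => hiddenVariableLaw τ hmin).prod
    (Measure.pi fun _ : Sym2 V => (volume : Measure unitInterval))) (patternEvent τ hmin n H)

theorem measurable_connectionProb (τ hmin : ℝ) (n : ℕ) :
    Measurable fun p : ℝ × ℝ => connectionProb τ hmin n p.1 p.2 := by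
  unfold connectionProb
  fun_prop

theorem measurableSet_patternEvent {V : Type*} [Finite V] (τ hmin : ℝ) (n : ℕ)
    (H : SimpleGraph V) : MeasurableSet (patternEvent τ hmin n H) := by
  have : Countable V := Finite.to_countable
  simp only [patternEvent, Set.ofPred_forall]
  refine MeasurableSet.iInter fun u => MeasurableSet.iInter fun v => MeasurableSet.iInter fun _ =>
    MeasurableSet.iff (measurableSet_lt ?_ ?_) (MeasurableSet.const _)
  · exact measurable_subtype_coe.comp ((measurable_pi_apply _).comp measurable_snd)
  · have hu : Measurable fun ω : (V → ℝ) × (Sym2 V → unitInterval) => ω.1 u :=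
      (measurable_pi_apply u).comp measurable_fst
    have hv : Measurable fun ω : (V → ℝ) × (Sym2 V → unitInterval) => ω.1 v :=
      (measurable_pi_apply v).comp measurable_fst
    exact (measurable_connectionProb τ hmin n).comp (hu.prodMk hv)

variable {V : Type*}

/-- The event that the vertices `φ v` induce `H`. -/
def embeddedEvent (τ hmin : ℝ) (n : ℕ) (H : SimpleGraph V) (φ : V ↪ Fin n) :
    Set (HiddenVariableSample n) :=
  {ω | ∀ u v, (hiddenVariableGraph τ hmin n ω).Adj (φ u) (φ v) ↔ H.Adj u v}

/-- Only the variables of the vertices `φ v` and of the pairs between them matter, so the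
probability of the event does not depend on `φ`. -/
theorem embeddedEvent_eq_preimage (τ hmin : ℝ) (n : ℕ) (H : SimpleGraph V) (φ : V ↪ Fin n) :
    embeddedEvent τ hmin n H φ =
      Prod.map (fun x : Fin n → ℝ => x ∘ φ)
        (fun y : Sym2 (Fin n) → unitInterval => y ∘ Sym2.map φ) ⁻¹' patternEvent τ hmin n H := by
  ext ω
  simp only [embeddedEvent, patternEvent, hiddenVariableGraph, Set.mem_preimage,
    Set.mem_ofPred_eq, Prod.map, Function.comp_apply, Sym2.map_mk]
  refine forall_congr' fun u => forall_congr' fun v => ?_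
  by_cases huv : u = v
  · subst huv
    simp
  · have : φ u ≠ φ v := φ.injective.ne huv
    simp [huv]

theorem nonempty_induce_iso_iff {W : Type*} (G : SimpleGraph W) (H : SimpleGraph V) (S : Set W) :
    Nonempty (G.induce S ≃g H) ↔
      ∃ φ : V ↪ W, Set.range φ = S ∧ ∀ u v, G.Adj (φ u) (φ v) ↔ H.Adj u v := by
  constructor
  · rintro ⟨f⟩
    refine ⟨f.symm.toEquiv.toEmbedding.trans (Function.Embedding.subtype _), ?_, fun u v => ?_⟩
    · ext w
      constructor
      · rintro ⟨v, rfl⟩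
        exact (f.symm v).2
      · intro hw
        exact ⟨f ⟨w, hw⟩, by simp⟩
    · exact f.symm.map_adj_iff
  · rintro ⟨φ, rfl, h⟩
    exact ⟨(RelIso.mk (Equiv.ofInjective φ φ.injective) fun {u v} => h u v : H ≃g _).symm⟩

variable [Fintype V]

theorem measurableSet_embeddedEvent (τ hmin : ℝ) (n : ℕ) (H : SimpleGraph V) (φ : V ↪ Fin n) :
    MeasurableSet (embeddedEvent τ hmin n H φ) := by
  rw [embeddedEvent_eq_preimage]
  refine (Measurable.prodMap ?_ ?_) (measurableSet_patternEvent τ hmin n H)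
  · exact measurable_pi_lambda _ fun i => measurable_pi_apply _
  · exact measurable_pi_lambda _ fun i => measurable_pi_apply _

theorem hiddenVariableMeasure_embeddedEvent {τ hmin : ℝ} (hτ : 2 < τ) (hh : 0 < hmin) (n : ℕ)
    (H : SimpleGraph V) (φ : V ↪ Fin n) :
    hiddenVariableMeasure τ hmin n (embeddedEvent τ hmin n H φ) = patternProb τ hmin n H := by
  classical
  have := isProbabilityMeasure_hiddenVariableLaw hτ hh
  rw [embeddedEvent_eq_preimage, hiddenVariableMeasure, patternProb]
  exact ((measurePreserving_comp_injective (hiddenVariableLaw τ hmin) φ.injective).prod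
    (measurePreserving_comp_injective (volume : Measure unitInterval)
      (Sym2.map.injective φ.injective))).measure_preimage
    (measurableSet_patternEvent τ hmin n H).nullMeasurableSet

/-- Automorphisms of `H` let several embeddings with the same range `S` succeed together, hence a
union over embeddings for each `S`. The union bound gives the upper estimate below, and a single
embedding per `S` the lower one. -/
theorem expectedGraphletCount_eq {τ hmin : ℝ} (hτ : 2 < τ) (hh : 0 < hmin) (n : ℕ)
    (H : SimpleGraph V) :
    expectedGraphletCount τ hmin H n =
      (∑ S : Set (Fin n), hiddenVariableMeasure τ hmin n
        (⋃ (φ : V ↪ Fin n) (_ : Set.range φ = S), embeddedEvent τ hmin n H φ)).toReal := by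
  classical
  have := isProbabilityMeasure_hiddenVariableLaw hτ hh
  have : IsProbabilityMeasure (hiddenVariableMeasure τ hmin n) := by
    unfold hiddenVariableMeasure; infer_instance
  have hmeas : ∀ S : Set (Fin n), MeasurableSet
      (⋃ (φ : V ↪ Fin n) (_ : Set.range φ = S), embeddedEvent τ hmin n H φ) := fun S =>
    MeasurableSet.iUnion fun φ => MeasurableSet.iUnion fun _ => measurableSet_embeddedEvent _ _ _ _ _
  have hcount : ∀ ω, (graphletCount H (hiddenVariableGraph τ hmin n ω) : ℝ) =
      ∑ S : Set (Fin n), (⋃ (φ : V ↪ Fin n) (_ : Set.range φ = S),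
        embeddedEvent τ hmin n H φ).indicator (fun _ => (1 : ℝ)) ω := by
    intro ω
    rw [graphletCount, Set.ncard_eq_toFinset_card']
    simp only [Set.indicator_apply, Finset.sum_boole]
    congr 2
    ext S
    simp [nonempty_induce_iso_iff, embeddedEvent]
  rw [expectedGraphletCount]
  simp_rw [hcount]
  rw [integral_finsetSum _ fun S _ => (integrable_const _).indicator (hmeas S),
    ENNReal.toReal_sum fun S _ => measure_ne_top _ _]
  refine Finset.sum_congr rfl fun S _ => ?_
  rw [integral_indicator_const _ (hmeas S)]
  simp [Measure.real]

theorem patternProb_ne_top {τ hmin : ℝ} (hτ : 2 < τ) (hh : 0 < hmin) (n : ℕ)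
    (H : SimpleGraph V) : patternProb τ hmin n H ≠ ⊤ := by
  classical
  have := isProbabilityMeasure_hiddenVariableLaw hτ hh
  rw [patternProb]
  exact measure_ne_top _ _

theorem expectedGraphletCount_le {τ hmin : ℝ} (hτ : 2 < τ) (hh : 0 < hmin) (n : ℕ)
    (H : SimpleGraph V) :
    expectedGraphletCount τ hmin H n ≤
      (n : ℝ) ^ Fintype.card V * (patternProb τ hmin n H).toReal := by
  classical
  rw [expectedGraphletCount_eq hτ hh]
  have hle : ∑ S : Set (Fin n), hiddenVariableMeasure τ hmin n
        (⋃ (φ : V ↪ Fin n) (_ : Set.range φ = S), embeddedEvent τ hmin n H φ) ≤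
      ((n ^ Fintype.card V : ℕ) : ENNReal) * patternProb τ hmin n H := by
    calc _ ≤ ∑ S : Set (Fin n), ∑ φ ∈ (Finset.univ : Finset (V ↪ Fin n)).filter
            (fun φ : V ↪ Fin n => Set.range φ = S),
          patternProb τ hmin n H := by
          refine Finset.sum_le_sum fun S _ => ?_
          have : (⋃ (φ : V ↪ Fin n) (_ : Set.range φ = S), embeddedEvent τ hmin n H φ) =
              ⋃ φ ∈ Finset.univ.filter fun φ : V ↪ Fin n => Set.range φ = S,
                embeddedEvent τ hmin n H φ := by
            simp
          rw [this]
          refine (measure_biUnion_finset_le _ _).trans (Finset.sum_le_sum fun φ _ => ?_)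
          rw [hiddenVariableMeasure_embeddedEvent hτ hh]
      _ = ∑ φ : V ↪ Fin n, patternProb τ hmin n H :=
          Finset.sum_fiberwise _ _ _
      _ ≤ _ := by
          rw [Finset.sum_const, nsmul_eq_mul, Finset.card_univ, Fintype.card_embedding_eq,
            Fintype.card_fin]
          gcongr
          exact Nat.descFactorial_le_pow _ _
  refine (ENNReal.toReal_mono (ENNReal.mul_ne_top (ENNReal.natCast_ne_top _)
    (patternProb_ne_top hτ hh n H)) hle).trans_eq ?_
  simp

theorem le_expectedGraphletCount {τ hmin : ℝ} (hτ : 2 < τ) (hh : 0 < hmin) (n : ℕ)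
    (H : SimpleGraph V) :
    (n.choose (Fintype.card V) : ℝ) * (patternProb τ hmin n H).toReal ≤
      expectedGraphletCount τ hmin H n := by
  classical
  have := isProbabilityMeasure_hiddenVariableLaw hτ hh
  have : IsProbabilityMeasure (hiddenVariableMeasure τ hmin n) := by
    unfold hiddenVariableMeasure; infer_instance
  rw [expectedGraphletCount_eq hτ hh]
  have hle : ((n.choose (Fintype.card V) : ℕ) : ENNReal) * patternProb τ hmin n H ≤
      ∑ S : Set (Fin n), hiddenVariableMeasure τ hmin n
        (⋃ (φ : V ↪ Fin n) (_ : Set.range φ = S), embeddedEvent τ hmin n H φ) := by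
    calc _ = ∑ s ∈ (Finset.univ : Finset (Fin n)).powersetCard (Fintype.card V),
          patternProb τ hmin n H := by
          rw [Finset.sum_const, nsmul_eq_mul, Finset.card_powersetCard, Finset.card_univ,
            Fintype.card_fin]
      _ ≤ ∑ s ∈ (Finset.univ : Finset (Fin n)).powersetCard (Fintype.card V),
          hiddenVariableMeasure τ hmin n (⋃ (φ : V ↪ Fin n)
            (_ : Set.range φ = (s : Set (Fin n))), embeddedEvent τ hmin n H φ) := by
          refine Finset.sum_le_sum fun s hs => ?_
          have hcard : Fintype.card V = Fintype.card s := by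
            rw [Fintype.card_coe, (Finset.mem_powersetCard.1 hs).2]
          let e : V ≃ s := Fintype.equivOfCardEq hcard
          let φ : V ↪ Fin n := e.toEmbedding.trans (Function.Embedding.subtype _)
          have hφ : Set.range φ = (s : Set (Fin n)) := by
            ext w
            constructor
            · rintro ⟨v, rfl⟩
              exact (e v).2
            · intro hw
              exact ⟨e.symm ⟨w, hw⟩, by simp [φ]⟩
          rw [← hiddenVariableMeasure_embeddedEvent hτ hh n H φ]
          exact measure_mono (Set.subset_biUnion_of_mem (u := fun φ => embeddedEvent τ hmin n H φ)
            (s := {φ : V ↪ Fin n | Set.range φ = s}) hφ)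
      _ = ∑ S ∈ ((Finset.univ : Finset (Fin n)).powersetCard (Fintype.card V)).image
            (fun s : Finset (Fin n) => (s : Set (Fin n))), hiddenVariableMeasure τ hmin n (⋃ (φ : V ↪ Fin n)
            (_ : Set.range φ = S), embeddedEvent τ hmin n H φ) := by
          rw [Finset.sum_image Finset.coe_injective.injOn]
      _ ≤ _ := Finset.sum_le_sum_of_subset (Finset.subset_univ _)
  have := ENNReal.toReal_mono (by
    simp [ENNReal.sum_eq_top, measure_ne_top]) hle
  simpa using this

theorem volume_coe_lt {p : ℝ} (hp0 : 0 ≤ p) (hp1 : p ≤ 1) :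
    volume {t : unitInterval | (t : ℝ) < p} = ENNReal.ofReal p :=
  unitInterval.volume_Iio (⟨p, hp0, hp1⟩ : unitInterval)

theorem volume_not_coe_lt {p : ℝ} (hp0 : 0 ≤ p) (hp1 : p ≤ 1) :
    volume {t : unitInterval | ¬ (t : ℝ) < p} = ENNReal.ofReal (1 - p) := by
  have : {t : unitInterval | ¬ (t : ℝ) < p} = Set.Ici (⟨p, hp0, hp1⟩ : unitInterval) := by
    ext t
    simp [← Subtype.coe_le_coe]
  rw [this, unitInterval.volume_Ici]

open Classical in
/-- The conditional probability that a pair has the status prescribed by `H`. -/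
def pairWeight (τ hmin : ℝ) (n : ℕ) (H : SimpleGraph V) (h : V → ℝ) (e : Sym2 V) : ℝ :=
  if e.IsDiag then 1 else if e ∈ H.edgeSet then pairProb τ hmin n h e
    else 1 - pairProb τ hmin n h e

/-- For fixed hidden variables the event is a box in the pair variables. Diagonal elements of `Sym2
V` impose no condition and contribute the factor `1`. -/
theorem patternProb_eq {τ hmin : ℝ} (hτ : 2 < τ) (hh : 0 < hmin) (n : ℕ) (H : SimpleGraph V) :
    patternProb τ hmin n H = ∫⁻ h, ∏ e, ENNReal.ofReal (pairWeight τ hmin n H h e)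
      ∂(Measure.pi fun _ : V => hiddenVariableLaw τ hmin) := by
  classical
  have := isProbabilityMeasure_hiddenVariableLaw hτ hh
  rw [patternProb, Measure.prod_apply (measurableSet_patternEvent τ hmin n H)]
  have hae : ∀ᵐ h ∂(Measure.pi fun _ : V => hiddenVariableLaw τ hmin), ∀ v, hmin ≤ h v :=
    eventually_all.2 fun v => (measurePreserving_eval (fun _ : V => hiddenVariableLaw τ hmin)
      v).quasiMeasurePreserving.ae (ae_paretoMeasure_ge hmin (τ - 1))
  refine lintegral_congr_ae (hae.mono fun h hpos => ?_)
  have hsec : Prod.mk h ⁻¹' patternEvent τ hmin n H = Set.univ.pi fun e : Sym2 V =>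
      {t : unitInterval | ¬ e.IsDiag →
        ((t : ℝ) < pairProb τ hmin n h e ↔ e ∈ H.edgeSet)} := by
    ext y
    simp only [patternEvent, Set.mem_preimage, Set.mem_ofPred_eq, Set.mem_univ_pi, Sym2.forall,
      Sym2.mk_isDiag_iff, pairProb_mk, SimpleGraph.mem_edgeSet, ne_eq]
  dsimp only
  rw [hsec, Measure.pi_pi]
  refine Finset.prod_congr rfl fun e _ => ?_
  have hp0 : 0 ≤ pairProb τ hmin n h e := by
    induction e with | _ u v
    have := hiddenVariableMean_pos hτ hh
    have := hh.trans_le (hpos u)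
    have := hh.trans_le (hpos v)
    simp only [pairProb_mk, connectionProb]
    positivity
  have hp1 : pairProb τ hmin n h e ≤ 1 := by
    induction e with | _ u v
    exact min_le_right _ _
  by_cases hd : e.IsDiag
  · simp [pairWeight, hd]
  · by_cases he : e ∈ H.edgeSet
    · simp only [pairWeight, hd, he, not_false_eq_true, forall_const, iff_true, if_false, if_true]
      exact volume_coe_lt hp0 hp1
    · simp only [pairWeight, hd, he, not_false_eq_true, forall_const, iff_false, if_false]
      exact volume_not_coe_lt hp0 hp1

end

/-! ### The order of the pattern probability -/

noncomputable section

open VertexPartition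

/-- The scale `√(μ n)` of the hidden variables. -/
def hiddenScale (τ hmin : ℝ) (n : ℕ) : ℝ := √(hiddenVariableMean τ hmin * n)

theorem hiddenScale_pos {τ hmin : ℝ} (hτ : 2 < τ) (hh : 0 < hmin) {n : ℕ} (hn : 0 < n) :
    0 < hiddenScale τ hmin n := by
  have := hiddenVariableMean_pos hτ hh
  exact Real.sqrt_pos.2 (by positivity)

theorem tendsto_hiddenScale {τ hmin : ℝ} (hτ : 2 < τ) (hh : 0 < hmin) :
    Tendsto (hiddenScale τ hmin) atTop atTop :=
  Real.tendsto_sqrt_atTop.comp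
    (tendsto_natCast_atTop_atTop.const_mul_atTop (hiddenVariableMean_pos hτ hh))

/-- The hidden variables in logarithmic coordinates. -/
def logCoord {V : Type*} (s : ℝ) (h : V → ℝ) (v : V) : ℝ := Real.log (h v / s)

theorem pairProb_eq_exp {V : Type*} {τ hmin : ℝ} (hτ : 2 < τ) (hh : 0 < hmin) {n : ℕ}
    (hn : 0 < n) {h : V → ℝ} (hpos : ∀ v, 0 < h v) (e : Sym2 V) :
    pairProb τ hmin n h e =
      Real.exp (min (pairSum e (logCoord (hiddenScale τ hmin n) h)) 0) := by
  induction e with | _ u v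
  have hs := hiddenScale_pos hτ hh hn
  have hM := hiddenVariableMean_pos hτ hh
  have hs2 : hiddenVariableMean τ hmin * n = hiddenScale τ hmin n * hiddenScale τ hmin n :=
    (Real.mul_self_sqrt (by positivity)).symm
  rw [Real.exp_monotone.map_min, Real.exp_zero, pairSum_mk, logCoord, logCoord, Real.exp_add,
    Real.exp_log (div_pos (hpos u) hs), Real.exp_log (div_pos (hpos v) hs), pairProb_mk,
    connectionProb, hs2, mul_div_mul_comm]

variable {V : Type*}

theorem expectedGraphletCount_nonneg (τ hmin : ℝ) (H : SimpleGraph V) (n : ℕ) :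
    0 ≤ expectedGraphletCount τ hmin H n :=
  integral_nonneg fun _ => Nat.cast_nonneg _

variable [Fintype V]

/-- The bound on `logWeight` becomes a product over vertices. The term `(τ - 1) * log (h v / s)`
appears because `logWeight` already includes the density, which is still to be integrated here. -/
theorem prod_pairWeight_le {τ hmin : ℝ} (hτ : 2 < τ) (hh : 0 < hmin) {H : SimpleGraph V}
    {P : VertexPartition V} {c : ℝ}
    (hc : ∀ (L : ℝ) (x : V → ℝ), 0 ≤ L → (∀ v, -L ≤ x v) →
      (∀ u v, u ≠ v → ¬ H.Adj u v → x u + x v ≤ 0) →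
      logWeight τ H x ≤ L * ((τ - 1) * objective τ H P) - c * ∑ v, |x v - L * exponent P v|)
    {n : ℕ} (hn : 0 < n) (hs : hmin ≤ hiddenScale τ hmin n) {h : V → ℝ} (hpos : ∀ v, hmin ≤ h v) :
    ∏ e, ENNReal.ofReal (pairWeight τ hmin n H h e) ≤
      ENNReal.ofReal (Real.exp (Real.log (hiddenScale τ hmin n / hmin) *
        ((τ - 1) * objective τ H P))) *
      ∏ v, ENNReal.ofReal (Real.exp ((τ - 1) * Real.log (h v / hiddenScale τ hmin n) -
        c * |Real.log (h v / hiddenScale τ hmin n) -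
          Real.log (hiddenScale τ hmin n / hmin) * exponent P v|)) := by
  classical
  have hpos' : ∀ v, 0 < h v := fun v => hh.trans_le (hpos v)
  have hs0 := hiddenScale_pos hτ hh hn
  set s := hiddenScale τ hmin n with hs_def
  set x := logCoord s h with hx
  set L := Real.log (s / hmin) with hL
  have hp := pairProb_eq_exp hτ hh hn hpos'
  rw [← hs_def, ← hx] at hp
  -- If a non-edge violates the constraint, its connection probability is `1` and the whole product
  -- vanishes.
  by_cases hnon : ∀ u v, u ≠ v → ¬ H.Adj u v → x u + x v ≤ 0
  · have hL0 : 0 ≤ L := Real.log_nonneg ((one_le_div hh).2 hs)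
    have hxL : ∀ v, -L ≤ x v := by
      intro v
      rw [hL, ← Real.log_inv, inv_div]
      exact Real.log_le_log (by positivity) (div_le_div_of_nonneg_right (hpos v) hs0.le)
    have hw := hc L x hL0 hxL hnon
    calc _ ≤ ∏ e, (if e ∈ H.edgeFinset then
          ENNReal.ofReal (Real.exp (min (pairSum e x) 0)) else 1) := by
          refine Finset.prod_le_prod' fun e _ => ?_
          by_cases he : e ∈ H.edgeSet
          · have hd : ¬ e.IsDiag := H.not_isDiag_of_mem_edgeSet he
            simp [pairWeight, hd, he, hp]
          · have : pairWeight τ hmin n H h e ≤ 1 := by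
              rw [pairWeight, if_neg he, hp]
              split_ifs
              · exact le_rfl
              · linarith [Real.exp_pos (min (pairSum e x) 0)]
            simpa [he] using this
      _ = ENNReal.ofReal (Real.exp (∑ e ∈ H.edgeFinset, min (pairSum e x) 0)) := by
          rw [Finset.prod_ite_mem, Finset.univ_inter, Real.exp_sum,
            ENNReal.ofReal_prod_of_nonneg fun _ _ => (Real.exp_pos _).le]
      _ ≤ _ := by
          rw [← ENNReal.ofReal_prod_of_nonneg fun _ _ => (Real.exp_pos _).le, ← Real.exp_sum,
            ← ENNReal.ofReal_mul (Real.exp_pos _).le, ← Real.exp_add]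
          apply ENNReal.ofReal_le_ofReal
          apply Real.exp_le_exp.2
          rw [Finset.sum_sub_distrib, ← Finset.mul_sum, ← Finset.mul_sum]
          have : logWeight τ H x =
            ∑ e ∈ H.edgeFinset, min (pairSum e x) 0 - (τ - 1) * ∑ v, x v := rfl
          rw [this] at hw
          simp only [hx, logCoord] at hw ⊢
          linarith
  · push Not at hnon
    obtain ⟨u, v, huv, hadj, hlt⟩ := hnon
    have hzero : pairWeight τ hmin n H h s(u, v) = 0 := by
      rw [pairWeight, if_neg (by simpa using huv), if_neg (by simpa using hadj), hp, pairSum_mk,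
        min_eq_right hlt.le]
      simp
    rw [Finset.prod_eq_zero (Finset.mem_univ s(u, v)) (by rw [hzero, ENNReal.ofReal_zero])]
    exact zero_le

theorem exists_patternProb_le {τ hmin : ℝ} (hτ : 2 < τ) (hh : 0 < hmin) {H : SimpleGraph V}
    {P : VertexPartition V} (hP : IsOptimizer τ H P)
    (hunique : ∀ Q : VertexPartition V, IsOptimizer τ H Q → Q = P) :
    ∃ K, 0 < K ∧ ∀ᶠ n : ℕ in atTop, (patternProb τ hmin n H).toReal ≤
      K * ((hiddenScale τ hmin n ^ (-(τ - 1))) ^ Fintype.card V *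
        Real.exp (Real.log (hiddenScale τ hmin n / hmin) * ((τ - 1) * objective τ H P))) := by
  obtain ⟨c, hc0, hc⟩ := logWeight_le_of_unique hτ hP hunique
  have hr : 0 < τ - 1 := by linarith
  have := isProbabilityMeasure_hiddenVariableLaw hτ hh
  set K := (τ - 1) * hmin ^ (τ - 1) * (2 / c) with hK
  have hK0 : 0 < K := by positivity
  refine ⟨K ^ Fintype.card V, by positivity, ?_⟩
  filter_upwards [eventually_gt_atTop 0, (tendsto_hiddenScale hτ hh).eventually_ge_atTop hmin]
    with n hn hs
  have hs0 := hiddenScale_pos hτ hh hn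
  set s := hiddenScale τ hmin n with hs_def
  set L := Real.log (s / hmin) with hL
  have hae : ∀ᵐ h ∂(Measure.pi fun _ : V => hiddenVariableLaw τ hmin), ∀ v, hmin ≤ h v :=
    eventually_all.2 fun v => (measurePreserving_eval (fun _ : V => hiddenVariableLaw τ hmin)
      v).quasiMeasurePreserving.ae (ae_paretoMeasure_ge hmin (τ - 1))
  apply ENNReal.toReal_le_of_le_ofReal (by positivity)
  rw [patternProb_eq hτ hh]
  refine (lintegral_mono_ae (hae.mono fun h hpos => prod_pairWeight_le hτ hh hc hn hs hpos)).trans ?_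
  rw [lintegral_const_mul' _ _ ENNReal.ofReal_ne_top, lintegral_pi_prod (hiddenVariableLaw τ hmin)
    (f := fun v a => ENNReal.ofReal (Real.exp ((τ - 1) * Real.log (a / s) -
        c * |Real.log (a / s) - L * exponent P v|))) (fun v => by fun_prop)]
  calc _ ≤ ENNReal.ofReal (Real.exp (L * ((τ - 1) * objective τ H P))) *
        ∏ _v : V, ENNReal.ofReal (K * s ^ (-(τ - 1))) := by
        gcongr with v
        exact lintegral_exp_log_paretoMeasure_le hh hr hc0 hs0 _
    _ = _ := by
        rw [Finset.prod_const, Finset.card_univ, ← ENNReal.ofReal_pow (by positivity),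
          ← ENNReal.ofReal_mul (by positivity)]
        congr 1
        rw [mul_pow]
        ring

/-- The lower end, in logarithmic coordinates, of the interval around the optimizer. -/
def boxCorner (P : VertexPartition V) (L : ℝ) (v : V) : ℝ :=
  L * exponent P v - if P v = 0 then 0 else 3

-- The box stays within bounded distance of `L z`, and each pair loses at most `2 * 3 = 6` in the
-- exponent. On `S₁` the corner is `-L`, the edge of the support, so it cannot be lowered. Lowering
-- the other labels by `3` leaves non-edges with sum at most `-1`, the tight case being `S₁`–`S₂`
-- with `(-L + 1) + (L - 3 + 1) = -1`; the probability of absence is then at least `1 / 2`.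
open Classical in
theorem le_pairWeight {τ hmin : ℝ} (hτ : 2 < τ) (hh : 0 < hmin) {H : SimpleGraph V}
    {P : VertexPartition V} (hP : Feasible H P) {n : ℕ} (hn : 0 < n) {h : V → ℝ}
    (hpos : ∀ v, 0 < h v) {L : ℝ} (hL : 3 ≤ L)
    (hl : ∀ v, boxCorner P L v ≤ logCoord (hiddenScale τ hmin n) h v)
    (hu : ∀ v, logCoord (hiddenScale τ hmin n) h v ≤ boxCorner P L v + 1) (e : Sym2 V) :
    Real.exp (-6) * Real.exp (if e ∈ H.edgeFinset then
      min (pairSum e fun v => L * exponent P v) 0 else 0) ≤ pairWeight τ hmin n H h e := by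
  rw [← Real.exp_add, pairWeight, pairProb_eq_exp hτ hh hn hpos]
  set x := logCoord (hiddenScale τ hmin n) h
  by_cases hd : e.IsDiag
  · have he : e ∉ H.edgeSet := fun he => H.not_isDiag_of_mem_edgeSet he hd
    simp [hd, he]
  rw [if_neg hd]
  induction e with | _ u v
  have hbox : ∀ w, L * exponent P w - 3 ≤ boxCorner P L w := by
    intro w
    unfold boxCorner
    split_ifs <;> linarith
  by_cases he : s(u, v) ∈ H.edgeSet
  · rw [if_pos he, if_pos (by simpa using he)]
    apply Real.exp_le_exp.2
    simp only [pairSum_mk]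
    have h1 := (hbox u).trans (hl u)
    have h2 := (hbox v).trans (hl v)
    rcases min_cases (L * exponent P u + L * exponent P v) 0 with h3 | h3 <;>
      rcases min_cases (x u + x v) 0 with h4 | h4 <;> linarith
  · rw [if_neg he, if_neg (by simpa using he)]
    have huv : u ≠ v := by simpa using hd
    have hsum : x u + x v ≤ -1 := by
      have h0 := feasible_iff.1 hP u v huv (by simpa using he)
      have h1 := hu u
      have h2 := hu v
      unfold boxCorner exponent at *
      split_ifs at h0 h1 h2 <;> linarith
    have h1 : Real.exp (min (pairSum s(u, v) x) 0) ≤ Real.exp (-1) :=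
      Real.exp_le_exp.2 ((min_le_left _ _).trans hsum)
    have h2 : Real.exp (-6 + 0) ≤ Real.exp (-1) := Real.exp_le_exp.2 (by norm_num)
    have h3 : Real.exp (-1) ≤ 1 / 2 := by
      rw [Real.exp_neg, ← one_div]
      exact one_div_le_one_div_of_le two_pos (by linarith [Real.add_one_le_exp 1])
    linarith

theorem exists_le_patternProb {τ hmin : ℝ} (hτ : 2 < τ) (hh : 0 < hmin) {H : SimpleGraph V}
    {P : VertexPartition V} (hP : Feasible H P) :
    ∃ K, 0 < K ∧ ∀ᶠ n : ℕ in atTop,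
      K * ((hiddenScale τ hmin n ^ (-(τ - 1))) ^ Fintype.card V *
        Real.exp (Real.log (hiddenScale τ hmin n / hmin) * ((τ - 1) * objective τ H P))) ≤
      (patternProb τ hmin n H).toReal := by
  classical
  have hr : 0 < τ - 1 := by linarith
  have := isProbabilityMeasure_hiddenVariableLaw hτ hh
  set K := (τ - 1) * hmin ^ (τ - 1) * Real.exp (-(τ - 1 + 1)) with hK
  have hK0 : 0 < K := by positivity
  refine ⟨Real.exp (-6) ^ Fintype.card (Sym2 V) * K ^ Fintype.card V, by positivity, ?_⟩
  -- The threshold `hmin * exp 3` gives `L ≥ 3`, which keeps the whole box above `hmin`.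
  filter_upwards [eventually_gt_atTop 0,
    (tendsto_hiddenScale hτ hh).eventually_ge_atTop (hmin * Real.exp 3)] with n hn hs
  have hs0 := hiddenScale_pos hτ hh hn
  set s := hiddenScale τ hmin n with hs_def
  set L := Real.log (s / hmin) with hL
  have hL3 : 3 ≤ L := by
    rw [hL, Real.le_log_iff_exp_le (by positivity), le_div_iff₀ hh]
    linarith
  have hsL : s * Real.exp (-L) = hmin := by
    rw [Real.exp_neg, hL, Real.exp_log (by positivity)]
    field_simp
  have hcorner : ∀ v, -L ≤ boxCorner P L v := by
    intro v
    unfold boxCorner exponent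
    split_ifs <;> linarith
  have hcorner' : ∀ v, boxCorner P L v ≤ L * exponent P v := by
    intro v
    unfold boxCorner
    split_ifs <;> linarith
  have hge : ∀ v, hmin ≤ s * Real.exp (boxCorner P L v) := fun v =>
    hsL.symm.le.trans (mul_le_mul_of_nonneg_left (Real.exp_le_exp.2 (hcorner v)) hs0.le)
  set I : V → Set ℝ := fun v =>
    Set.Icc (s * Real.exp (boxCorner P L v)) (Real.exp 1 * (s * Real.exp (boxCorner P L v)))
    with hI
  have hIm : MeasurableSet (Set.univ.pi I) := MeasurableSet.univ_pi fun v => measurableSet_Icc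
  set E := ∑ e ∈ H.edgeFinset, min (pairSum e fun v => L * exponent P v) 0 with hE
  have hEval : E = L * ((τ - 1) * objective τ H P) + (τ - 1) * ∑ v, L * exponent P v := by
    have h1 := logWeight_exponent hτ H P
    have h2 : E = L * ∑ e ∈ H.edgeFinset, min (pairSum e (exponent P)) 0 := by
      rw [hE, Finset.mul_sum]
      refine Finset.sum_congr rfl fun e _ => ?_
      rw [mul_min_of_nonneg _ _ (by linarith), mul_zero]
      congr 1
      exact (pairSum e).map_smul L (exponent P)
    rw [← h1, h2, logWeight, ← Finset.mul_sum]
    ring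
  rw [← ENNReal.ofReal_le_iff_le_toReal (patternProb_ne_top hτ hh n H), patternProb_eq hτ hh]
  calc _ ≤ ENNReal.ofReal (Real.exp (-6) ^ Fintype.card (Sym2 V) * Real.exp E) *
        ∏ v, ENNReal.ofReal (K * (s * Real.exp (boxCorner P L v)) ^ (-(τ - 1))) := by
        rw [← ENNReal.ofReal_prod_of_nonneg fun v _ => by positivity,
          ← ENNReal.ofReal_mul (by positivity)]
        apply ENNReal.ofReal_le_ofReal
        have hprod : K ^ Fintype.card V * (s ^ (-(τ - 1))) ^ Fintype.card V *
            Real.exp (-((τ - 1) * ∑ v, L * exponent P v)) ≤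
            ∏ v, K * (s * Real.exp (boxCorner P L v)) ^ (-(τ - 1)) := by
          rw [Finset.mul_sum, ← Finset.sum_neg_distrib, Real.exp_sum, ← mul_pow,
            ← Finset.card_univ, ← Finset.prod_const, ← Finset.prod_mul_distrib]
          -- The mass has a negative power of the left endpoint, so replacing the corner by the
          -- larger `L * exponent P v` only decreases it.
          refine Finset.prod_le_prod (fun v _ => by positivity) fun v _ => ?_
          rw [Real.mul_rpow hs0.le (Real.exp_pos _).le, ← Real.exp_mul, mul_assoc]
          gcongr
          nlinarith [hcorner' v]
        calc _ = Real.exp (-6) ^ Fintype.card (Sym2 V) * Real.exp E *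
              (K ^ Fintype.card V * (s ^ (-(τ - 1))) ^ Fintype.card V *
                Real.exp (-((τ - 1) * ∑ v, L * exponent P v))) := by
              have : Real.exp (L * ((τ - 1) * objective τ H P)) =
                  Real.exp E * Real.exp (-((τ - 1) * ∑ v, L * exponent P v)) := by
                rw [← Real.exp_add, hEval]
                congr 1
                ring
              rw [this]
              ring
          _ ≤ _ := by gcongr
    _ ≤ ENNReal.ofReal (Real.exp (-6) ^ Fintype.card (Sym2 V) * Real.exp E) *
        (Measure.pi fun _ : V => hiddenVariableLaw τ hmin) (Set.univ.pi I) := by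
        rw [Measure.pi_pi]
        gcongr with v
        exact le_paretoMeasure_Icc hh hr (hge v)
    _ = ∫⁻ _ in Set.univ.pi I,
          ENNReal.ofReal (Real.exp (-6) ^ Fintype.card (Sym2 V) * Real.exp E)
          ∂(Measure.pi fun _ : V => hiddenVariableLaw τ hmin) := (setLIntegral_const _ _).symm
    _ ≤ ∫⁻ h in Set.univ.pi I, ∏ e, ENNReal.ofReal (pairWeight τ hmin n H h e)
          ∂(Measure.pi fun _ : V => hiddenVariableLaw τ hmin) := by
        refine setLIntegral_mono' hIm fun h hmem => ?_
        have hmem' : ∀ v, h v ∈ I v := fun v => hmem v (Set.mem_univ v)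
        have hpos : ∀ v, 0 < h v := fun v => hh.trans_le ((hge v).trans (hmem' v).1)
        have hl : ∀ v, boxCorner P L v ≤ logCoord s h v := by
          intro v
          rw [logCoord, Real.le_log_iff_exp_le (div_pos (hpos v) hs0), le_div_iff₀ hs0, mul_comm]
          exact (hmem' v).1
        have hu : ∀ v, logCoord s h v ≤ boxCorner P L v + 1 := by
          intro v
          rw [logCoord, Real.log_le_iff_le_exp (div_pos (hpos v) hs0), div_le_iff₀ hs0,
            Real.exp_add]
          refine (hmem' v).2.trans_eq ?_
          ring
        have hw := le_pairWeight hτ hh hP hn hpos hL3 hl hu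
        calc _ = ∏ e : Sym2 V, ENNReal.ofReal (Real.exp (-6) *
              Real.exp (if e ∈ H.edgeFinset then
                min (pairSum e fun v => L * exponent P v) 0 else 0)) := by
              rw [← ENNReal.ofReal_prod_of_nonneg fun v _ => by positivity,
                Finset.prod_mul_distrib, Finset.prod_const, Finset.card_univ, ← Real.exp_sum,
                Finset.sum_ite_mem, Finset.univ_inter]
          _ ≤ _ := Finset.prod_le_prod' fun e _ => ENNReal.ofReal_le_ofReal (hw e)
    _ ≤ _ := setLIntegral_le_lintegral _ _

/-! ### Powers of `n` and conclusion -/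

/-- As `s` is of order `n ^ (1 / 2)`, the exponent of `n` is `k - (τ - 1) / 2 * k + (τ - 1) / 2 *
B`. -/
theorem scaling_eq {τ hmin : ℝ} (hτ : 2 < τ) (hh : 0 < hmin) {n : ℕ} (hn : 0 < n) (k : ℕ)
    (B : ℝ) :
    (n : ℝ) ^ k * ((hiddenScale τ hmin n ^ (-(τ - 1))) ^ k *
      Real.exp (Real.log (hiddenScale τ hmin n / hmin) * ((τ - 1) * B))) =
    hiddenVariableMean τ hmin ^ ((τ - 1) / 2 * (B - k)) * hmin ^ (-((τ - 1) * B)) *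
      (n : ℝ) ^ ((3 - τ) / 2 * (k : ℝ) + (τ - 1) / 2 * B) := by
  have hM := hiddenVariableMean_pos hτ hh
  have hs := hiddenScale_pos hτ hh hn
  have hn' : (0 : ℝ) < n := by exact_mod_cast hn
  have hlog : Real.log (hiddenScale τ hmin n) =
      (Real.log (hiddenVariableMean τ hmin) + Real.log n) / 2 := by
    rw [hiddenScale, Real.log_sqrt (by positivity), Real.log_mul hM.ne' hn'.ne']
  rw [← Real.rpow_natCast, ← Real.rpow_natCast, ← Real.rpow_mul hs.le,
    Real.rpow_def_of_pos hn', Real.rpow_def_of_pos hn', Real.rpow_def_of_pos hs,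
    Real.rpow_def_of_pos hM, Real.rpow_def_of_pos hh, Real.log_div hs.ne' hh.ne', hlog,
    ← Real.exp_add, ← Real.exp_add, ← Real.exp_add, ← Real.exp_add]
  congr 1
  ring

end

/-- For `τ ∈ (2, 3)` and a graph `H` on `k` vertices for which the constrained optimization problem
has the unique optimizer `P`, the expected number of induced copies of `H` in the hidden-variable
model on `n` vertices is of exact order `n ^ ((3 - τ) / 2 * k + (τ - 1) / 2 * B_{g,f}(H))`, and
`B_{g,f}(H)` is the objective at `P`. -/
theorem mainTheorem8 {V : Type*} [Fintype V] (H : SimpleGraph V) (τ hmin : ℝ)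
    (hτ₂ : 2 < τ) (hτ₃ : τ < 3) (hhmin : 0 < hmin)
    (P : VertexPartition V) (hP : VertexPartition.IsOptimizer τ H P)
    (hunique : ∀ Q : VertexPartition V, VertexPartition.IsOptimizer τ H Q → Q = P) :
    (fun n : ℕ => expectedGraphletCount τ hmin H n) =Θ[atTop]
        (fun n : ℕ => (n : ℝ) ^ ((3 - τ) / 2 * (Fintype.card V : ℝ)
          + (τ - 1) / 2 * graphletB τ H)) ∧
      graphletB τ H = VertexPartition.objective τ H P := by
  have hB : graphletB τ H = VertexPartition.objective τ H P :=
    (graphletB_isGreatest τ H).unique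
      ⟨⟨P, hP.1, rfl⟩, by rintro _ ⟨Q, hQ, rfl⟩; exact hP.2 Q hQ⟩
  refine ⟨?_, hB⟩
  rw [hB]
  obtain ⟨K₂, hK₂, hupper⟩ := exists_patternProb_le hτ₂ hhmin hP hunique
  obtain ⟨K₁, hK₁, hlower⟩ := exists_le_patternProb hτ₂ hhmin hP.1
  set g : ℕ → ℝ := fun n => (hiddenScale τ hmin n ^ (-(τ - 1))) ^ Fintype.card V *
    Real.exp (Real.log (hiddenScale τ hmin n / hmin) *
      ((τ - 1) * VertexPartition.objective τ H P)) with hg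
  have hg0 : ∀ n, 0 ≤ g n := fun n => by
    have : 0 ≤ hiddenScale τ hmin n := Real.sqrt_nonneg _
    positivity
  have hM := hiddenVariableMean_pos hτ₂ hhmin
  have hscale : (fun n : ℕ => (n : ℝ) ^ Fintype.card V * g n) =Θ[atTop]
      (fun n : ℕ => (n : ℝ) ^ ((3 - τ) / 2 * (Fintype.card V : ℝ)
          + (τ - 1) / 2 * VertexPartition.objective τ H P)) := by
    refine (EventuallyEq.isTheta ?_).trans ((isTheta_refl _ _).const_mul_left
      (c := hiddenVariableMean τ hmin ^ ((τ - 1) / 2 *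
        (VertexPartition.objective τ H P - Fintype.card V)) *
          hmin ^ (-((τ - 1) * VertexPartition.objective τ H P))) (by positivity))
    filter_upwards [eventually_gt_atTop 0] with n hn
    exact scaling_eq hτ₂ hhmin hn _ _
  refine IsTheta.trans ⟨?_, ?_⟩ hscale
  · refine IsBigO.of_bound K₂ ?_
    filter_upwards [hupper] with n hn
    rw [Real.norm_of_nonneg (expectedGraphletCount_nonneg τ hmin H n),
      Real.norm_of_nonneg (mul_nonneg (by positivity) (hg0 n))]
    calc _ ≤ _ := expectedGraphletCount_le hτ₂ hhmin n H
      _ ≤ (n : ℝ) ^ Fintype.card V * (K₂ * g n) := by gcongr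
      _ = _ := by ring
  -- The number of `k`-subsets is of order `n ^ k` for fixed `k`, so both counting bounds have the
  -- same order.
  · refine ((isTheta_choose (Fintype.card V)).symm.isBigO.mul (isBigO_refl g atTop)).trans ?_
    refine IsBigO.of_bound K₁⁻¹ ?_
    filter_upwards [hlower] with n hn
    rw [Real.norm_of_nonneg (expectedGraphletCount_nonneg τ hmin H n),
      Real.norm_of_nonneg (mul_nonneg (by positivity) (hg0 n)), inv_mul_eq_div, le_div_iff₀ hK₁]
    calc _ = (n.choose (Fintype.card V) : ℝ) * (K₁ * g n) := by ring
      _ ≤ (n.choose (Fintype.card V) : ℝ) * (patternProb τ hmin n H).toReal := by gcongr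
      _ ≤ _ := le_expectedGraphletCount hτ₂ hhmin n H
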